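/- Let $\mathscr H$ be a complex Hilbert space, let $C_1,\dots,C_n$ be arbitrary bounded operators on $\mathscr H$, and let $B,A_1,\dots,A_n$ be bounded self-adjoint operators on $\mathscr H$ such that $B-\sum_{i=1}^n C_i^*A_iC_i>0$ and $A_i>0$ for all $1\le i\le n$, where $X>0$ means that $X$ is positive and invertible. Put $D=\left(I+\sum_{i=1}^n C_i^*C_i\right)^{-1/2}$. Then $D>0$, $DBD>0$, and, with powers and logarithms taken in the continuous functional calculus and $\le$ denoting the usual (Loewner) order on self-adjoint operators, \begin{align*} &\text{(i)}\quad \Big(B-\sum_{i=1}^n C_i^*A_iC_i\Big)^{-1}+\sum_{i=1}^n C_i^*A_i^{-1}C_i\ \ge\ D^{-1}(DBD)^{-1}D^{-1};\\ &\text{(ii)}\quad \Big(B-\sum_{i=1}^n C_i^*A_iC_i\Big)^{p}+\sum_{i=1}^n C_i^*A_i^{p}C_i\ \ge\ D^{-1}(DBD)^{p}D^{-1}\quad\text{for every } p\in[-1,0]\cup[1,2];\\ &\text{(iii)}\quad \Big(B-\sum_{i=1}^n C_i^*A_iC_i\Big)^{p}+\sum_{i=1}^n C_i^*A_i^{p}C_i\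 \le\ D^{-1}(DBD)^{p}D^{-1}\quad\text{for every } p\in[0,1];\\ &\text{(iv)}\quad \log\Big(B-\sum_{i=1}^n C_i^*A_iC_i\Big)+\sum_{i=1}^n C_i^*\log(A_i)\,C_i\ \le\ D^{-1}\log(DBD)\,D^{-1}. \end{align*} -/

import Mathlib

/-!
Each of `a⁻¹` and `a²` satisfies Jensen's operator inequality
`f (∑ Kᵢ⋆ Xᵢ Kᵢ) ≤ ∑ Kᵢ⋆ f(Xᵢ) Kᵢ` for `∑ Kᵢ⋆ Kᵢ = 1`, because the gap is an
explicit sum of terms `T⋆ P T` with `P ≥ 0`. The powers with exponent in `(0, 1)` and `(1, 2)` are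
integrals of affine functions plus multiples of the resolvents `(t + a)⁻¹`, so they inherit
the inequality, reversed for `(0, 1)`, from the inverse. Inverting a concave power gives the
exponents in `[-1, 0)`, and `log a` is the limit of `(a ^ p - 1) / p` as `p` decreases to `0`.

Hua's inequality is Jensen's for the column `K = (D, C₁ D, …, Cₙ D)`: it satisfies
`∑ Kᵢ⋆ Kᵢ = D (1 + ∑ Cᵢ⋆ Cᵢ) D = 1` by the choice of `D`, and it combines
`(B - ∑ Cᵢ⋆ Aᵢ Cᵢ, A₁, …, Aₙ)` to `D B D`. It remains to conjugate by `D⁻¹`.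
-/

/-- The operator `D = (I + ∑ Cᵢ* Cᵢ)^{-1/2}` attached to bounded operators `C₁, …, Cₙ` on a
Hilbert space; the power is taken in the continuous functional calculus. -/
noncomputable def huaD {H : Type*} [NormedAddCommGroup H] [InnerProductSpace ℂ H]
    [CompleteSpace H] {n : ℕ} (C : Fin n → (H →L[ℂ] H)) : H →L[ℂ] H :=
  (1 + ∑ i, star (C i) * C i) ^ (-(1 / 2) : ℝ)

open Set MeasureTheory Filter Topology Matrix
open scoped Ring

section Definitions

variable {A : Type*} [Semiring A] [StarRing A]

/-- A set is C⋆-convex if it contains every C⋆-convex combination `∑ Kᵢ⋆ Xᵢ Kᵢ`, where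
`∑ Kᵢ⋆ Kᵢ = 1`, of its elements. -/
def CStarConvex (s : Set A) : Prop :=
  ∀ ⦃n : ℕ⦄ ⦃K X : Fin n → A⦄, ∑ i, star (K i) * K i = 1 → (∀ i, X i ∈ s) →
    ∑ i, star (K i) * X i * K i ∈ s

/-- A function is C⋆-convex on a C⋆-convex set if it satisfies Jensen's operator inequality for all
C⋆-convex combinations. Ordinary convexity is the case of scalar weights `Kᵢ`. -/
def CStarConvexOn [LE A] (s : Set A) (f : A → A) : Prop :=
  CStarConvex s ∧ ∀ ⦃n : ℕ⦄ ⦃K X : Fin n → A⦄, ∑ i, star (K i) * K i = 1 → (∀ i, X i ∈ s) →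
    f (∑ i, star (K i) * X i * K i) ≤ ∑ i, star (K i) * f (X i) * K i

end Definitions

/-- A function is C⋆-concave on a C⋆-convex set if it satisfies the reverse of Jensen's operator
inequality for all C⋆-convex combinations; this is encoded as C⋆-convexity of `-f`. -/
def CStarConcaveOn {A : Type*} [Ring A] [StarRing A] [LE A] (s : Set A) (f : A → A) : Prop :=
  CStarConvexOn s fun a => -f a

section Semiring

variable {A : Type*} [Semiring A] [StarRing A] {s t : Set A} {f g : A → A}

lemma cstarConvex_setOf_isSelfAdjoint : CStarConvex {a : A | IsSelfAdjoint a} :=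
  fun _ _ _ _ hX => isSelfAdjoint_sum _ fun i _ => (hX i).conjugate' _

lemma CStarConvexOn.subset [LE A] (hf : CStarConvexOn t f) (hst : s ⊆ t) (hs : CStarConvex s) :
    CStarConvexOn s f :=
  ⟨hs, fun _ _ _ hK hX => hf.2 hK fun i => hst (hX i)⟩

lemma CStarConvexOn.congr [LE A] (hf : CStarConvexOn s f) (hfg : EqOn f g s) :
    CStarConvexOn s g := by
  refine ⟨hf.1, fun n K X hK hX => ?_⟩
  simp_rw [← hfg (hf.1 hK hX), ← hfg (hX _)]
  exact hf.2 hK hX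

end Semiring

section StarOrderedRing

variable {A : Type*} [Ring A] [StarRing A] [PartialOrder A] [StarOrderedRing A]
  {s : Set A} {f g : A → A}

lemma cstarConvex_Ici_zero : CStarConvex (Ici (0 : A)) := fun _ _ _ _ hX =>
  Finset.sum_nonneg fun i _ => star_left_conjugate_nonneg (hX i) _

lemma CStarConvexOn.add (hf : CStarConvexOn s f) (hg : CStarConvexOn s g) :
    CStarConvexOn s fun a => f a + g a := by
  refine ⟨hf.1, fun n K X hK hX => ?_⟩
  simp_rw [mul_add, add_mul, Finset.sum_add_distrib]
  exact add_le_add (hf.2 hK hX) (hg.2 hK hX)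

/-- The gap in the inequality is the operator variance `∑ (Xᵢ Kᵢ - Kᵢ M)⋆ (Xᵢ Kᵢ - Kᵢ M)`, where
`M = ∑ Kᵢ⋆ Xᵢ Kᵢ`. -/
lemma cstarConvexOn_sq : CStarConvexOn {a : A | IsSelfAdjoint a} fun a => a ^ 2 := by
  refine ⟨cstarConvex_setOf_isSelfAdjoint, fun n K X hK hX => ?_⟩
  have hM := cstarConvex_setOf_isSelfAdjoint hK hX
  set M := ∑ i, star (K i) * X i * K i with hMdef
  have expand (i) : star (X i * K i - K i * M) * (X i * K i - K i * M) =
      star (K i) * X i ^ 2 * K i - star (K i) * X i * K i * M - M * (star (K i) * X i * K i)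
        + M * (star (K i) * K i) * M := by
    simp only [star_sub, star_mul, hM.star_eq, (hX i).star_eq, sub_mul, mul_sub, mul_assoc, pow_two]
    abel
  have variance : ∑ i, star (X i * K i - K i * M) * (X i * K i - K i * M) =
      ∑ i, star (K i) * X i ^ 2 * K i - M ^ 2 := by
    simp_rw [expand, Finset.sum_add_distrib, Finset.sum_sub_distrib, ← Finset.sum_mul,
      ← Finset.mul_sum, hK, ← hMdef, pow_two, mul_one]
    abel
  rw [← sub_nonneg, ← variance]
  exact Finset.sum_nonneg fun i _ => star_mul_self_nonneg _

end StarOrderedRing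

section HuaColumn

variable {A : Type*} [Ring A] [StarRing A] {n : ℕ} {C Y : Fin n → A} {D X : A} {s : Set A}

lemma sum_star_vecCons_mul_mul_vecCons :
    ∑ j, star (vecCons D (fun i => C i * D) j) * vecCons X Y j * vecCons D (fun i => C i * D) j =
      star D * (X + ∑ i, star (C i) * Y i * C i) * D := by
  simp [Fin.sum_univ_succ, mul_add, add_mul, Finset.mul_sum, Finset.sum_mul, mul_assoc]

lemma sum_star_vecCons_mul_vecCons (hD : star D * (1 + ∑ i, star (C i) * C i) * D = 1) :
    ∑ j, star (vecCons D (fun i => C i * D) j) * vecCons D (fun i => C i * D) j = 1 := by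
  rw [← hD]
  simp [Fin.sum_univ_succ, mul_add, add_mul, Finset.mul_sum, Finset.sum_mul, mul_assoc]

lemma CStarConvex.conjugate_add_sum_mem (hs : CStarConvex s)
    (hD : star D * (1 + ∑ i, star (C i) * C i) * D = 1) (hX : X ∈ s) (hY : ∀ i, Y i ∈ s) :
    star D * (X + ∑ i, star (C i) * Y i * C i) * D ∈ s := by
  rw [← sum_star_vecCons_mul_mul_vecCons]
  exact hs (sum_star_vecCons_mul_vecCons hD) (Fin.cases hX hY)

lemma CStarConvexOn.map_conjugate_add_sum_le [LE A] {f : A → A} (hf : CStarConvexOn s f)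
    (hD : star D * (1 + ∑ i, star (C i) * C i) * D = 1) (hX : X ∈ s) (hY : ∀ i, Y i ∈ s) :
    f (star D * (X + ∑ i, star (C i) * Y i * C i) * D) ≤
      star D * (f X + ∑ i, star (C i) * f (Y i) * C i) * D := by
  have jensen := hf.2 (sum_star_vecCons_mul_vecCons hD)
    (Fin.cases (motive := fun j => vecCons X Y j ∈ s) hX hY)
  have hcomp : ∀ j, f (vecCons X Y j) = vecCons (f X) (fun i => f (Y i)) j :=
    Fin.cases rfl fun _ => rfl
  simpa only [hcomp, sum_star_vecCons_mul_mul_vecCons] using jensen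

end HuaColumn

section Hua

variable {A : Type*} [Ring A] [StarRing A] [PartialOrder A] [StarOrderedRing A]
  {n : ℕ} {C Y : Fin n → A} {D B : A} {s : Set A} {f : A → A}

lemma CStarConvexOn.hua (hf : CStarConvexOn s f) (hD : IsStrictlyPositive D)
    (hDC : D * (1 + ∑ i, star (C i) * C i) * D = 1)
    (hB : B - ∑ i, star (C i) * Y i * C i ∈ s) (hY : ∀ i, Y i ∈ s) :
    D⁻¹ʳ * f (D * B * D) * D⁻¹ʳ ≤
      f (B - ∑ i, star (C i) * Y i * C i) + ∑ i, star (C i) * f (Y i) * C i := by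
  have hDs : star D = D := hD.isSelfAdjoint
  have jensen := hf.map_conjugate_add_sum_le (by rwa [hDs]) hB hY
  rw [sub_add_cancel, hDs] at jensen
  have := hD.isSelfAdjoint.ringInverse.conjugate_le_conjugate jensen
  obtain ⟨d, rfl⟩ := hD.isUnit
  simpa [mul_assoc] using this

lemma CStarConcaveOn.hua (hf : CStarConcaveOn s f) (hD : IsStrictlyPositive D)
    (hDC : D * (1 + ∑ i, star (C i) * C i) * D = 1)
    (hB : B - ∑ i, star (C i) * Y i * C i ∈ s) (hY : ∀ i, Y i ∈ s) :
    f (B - ∑ i, star (C i) * Y i * C i) + ∑ i, star (C i) * f (Y i) * C i ≤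
      D⁻¹ʳ * f (D * B * D) * D⁻¹ʳ := by
  simpa [← sub_eq_add_neg, add_comm] using neg_le_neg (CStarConvexOn.hua hf hD hDC hB hY)

end Hua

section RealAlgebra

variable {A : Type*} [Ring A] [StarRing A] [Algebra ℝ A] {n : ℕ} {K X : Fin n → A}

lemma smul_add_algebraMap_sum_star_mul_mul (r c : ℝ) (hK : ∑ i, star (K i) * K i = 1) :
    r • ∑ i, star (K i) * X i * K i + algebraMap ℝ A c =
      ∑ i, star (K i) * (r • X i + algebraMap ℝ A c) * K i := by
  simp_rw [Algebra.algebraMap_eq_smul_one, mul_add, add_mul, mul_smul_comm, smul_mul_assoc, mul_one,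
    Finset.sum_add_distrib, ← Finset.smul_sum, hK]

variable [PartialOrder A] {s t : Set A} {f : A → A}

lemma cstarConvexOn_smul_add_algebraMap (hs : CStarConvex s) (r c : ℝ) :
    CStarConvexOn s fun a => r • a + algebraMap ℝ A c :=
  ⟨hs, fun _ _ _ hK _ => (smul_add_algebraMap_sum_star_mul_mul r c hK).le⟩

lemma CStarConvexOn.comp_smul_add_algebraMap (hf : CStarConvexOn t f) (hs : CStarConvex s)
    {r c : ℝ} (hst : MapsTo (fun a => r • a + algebraMap ℝ A c) s t) :
    CStarConvexOn s fun a => f (r • a + algebraMap ℝ A c) := by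
  refine ⟨hs, fun _ _ _ hK hX => ?_⟩
  beta_reduce
  rw [smul_add_algebraMap_sum_star_mul_mul r c hK]
  exact hf.2 hK fun i => hst (hX i)

lemma CStarConvexOn.smul [PosSMulMono ℝ A] (hf : CStarConvexOn s f) {r : ℝ} (hr : 0 ≤ r) :
    CStarConvexOn s fun a => r • f a := by
  refine ⟨hf.1, fun _ _ _ hK hX => ?_⟩
  simp_rw [mul_smul_comm, smul_mul_assoc, ← Finset.smul_sum]
  exact smul_le_smul_of_nonneg_left (hf.2 hK hX) hr

end RealAlgebra

section Limits

variable {A : Type*} [Ring A] [StarRing A] [PartialOrder A] [TopologicalSpace A]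
  [IsTopologicalRing A] [OrderClosedTopology A] {s : Set A} {α : Type*}

lemma cstarConvexOn_of_tendsto {l : Filter α} [l.NeBot] {F : α → A → A} {f : A → A}
    (hs : CStarConvex s) (hF : ∀ᶠ p in l, CStarConvexOn s (F p))
    (hlim : ∀ a ∈ s, Tendsto (F · a) l (𝓝 (f a))) : CStarConvexOn s f := by
  refine ⟨hs, fun n K X hK hX => le_of_tendsto_of_tendsto (hlim _ (hs hK hX))
    (tendsto_finsetSum _ fun i _ => ((hlim _ (hX i)).const_mul _).mul_const _) ?_⟩
  filter_upwards [hF] with p hp using hp.2 hK hX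

end Limits

section CStarAlgebra

variable {A : Type*} [CStarAlgebra A] [PartialOrder A] [StarOrderedRing A]
  {s : Set A} {f : A → A}

lemma cstarConvexOn_integral {α : Type*} [MeasurableSpace α] {μ : Measure α} {F : α → A → A}
    (hs : CStarConvex s) (hF : ∀ᵐ t ∂μ, CStarConvexOn s (F t))
    (hint : ∀ a ∈ s, Integrable (F · a) μ) : CStarConvexOn s fun a => ∫ t, F t a ∂μ := by
  refine ⟨hs, fun n K X hK hX => ?_⟩
  have hterm (i) : Integrable (fun t => star (K i) * F t (X i) * K i) μ :=
    ((hint _ (hX i)).const_mul _).mul_const _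
  calc ∫ t, F t (∑ i, star (K i) * X i * K i) ∂μ
      ≤ ∫ t, ∑ i, star (K i) * F t (X i) * K i ∂μ := by
        refine integral_mono_ae (hint _ (hs hK hX)) (integrable_finsetSum _ fun i _ => hterm i) ?_
        filter_upwards [hF] with t ht using ht.2 hK hX
    _ = ∑ i, ∫ t, star (K i) * F t (X i) * K i ∂μ := integral_finsetSum _ fun i _ => hterm i
    _ = ∑ i, star (K i) * (∫ t, F t (X i) ∂μ) * K i := Finset.sum_congr rfl fun i _ =>
        (ContinuousLinearMap.mulLeftRight ℝ A (star (K i)) (K i)).integral_comp_comm (hint _ (hX i))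

lemma eventually_algebraMap_le {a : A} (ha : IsStrictlyPositive a) :
    ∀ᶠ r in 𝓝[>] (0 : ℝ), algebraMap ℝ A r ≤ a := by
  nontriviality A
  obtain ⟨r, hr, hra⟩ := (CFC.exists_pos_algebraMap_le_iff ha.isSelfAdjoint).2
    fun _ => ha.spectrum_pos
  filter_upwards [Ioo_mem_nhdsGT hr] with q hq using (algebraMap_mono A hq.2.le).trans hra

lemma cstarConvex_setOf_isStrictlyPositive : CStarConvex {a : A | IsStrictlyPositive a} := by
  intro n K X hK hX
  obtain ⟨r, hrX, hr : 0 < r⟩ :=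
    ((eventually_all.2 fun i => eventually_algebraMap_le (hX i)).and self_mem_nhdsWithin).exists
  refine (isStrictlyPositive_algebraMap (A := A) hr).of_le ?_
  calc algebraMap ℝ A r = ∑ i, star (K i) * algebraMap ℝ A r * K i := by
        simpa using smul_add_algebraMap_sum_star_mul_mul (X := X) 0 r hK
    _ ≤ ∑ i, star (K i) * X i * K i :=
        Finset.sum_le_sum fun i _ => star_left_conjugate_le_conjugate (hrX i) _

/-- With `N = (∑ Kᵢ⋆ Xᵢ Kᵢ)⁻¹`, the gap in the inequality is
`∑ (Xᵢ Kᵢ N - Kᵢ)⋆ Xᵢ⁻¹ (Xᵢ Kᵢ N - Kᵢ)`. -/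
lemma cstarConvexOn_ringInverse : CStarConvexOn {a : A | IsStrictlyPositive a} Ring.inverse := by
  refine ⟨cstarConvex_setOf_isStrictlyPositive, fun n K X hK hX => ?_⟩
  have hM := cstarConvex_setOf_isStrictlyPositive hK hX
  set M := ∑ i, star (K i) * X i * K i with hMdef
  have hN : star M⁻¹ʳ = M⁻¹ʳ := hM.isSelfAdjoint.ringInverse
  have expand (i) : star (X i * K i * M⁻¹ʳ - K i) * (X i)⁻¹ʳ * (X i * K i * M⁻¹ʳ - K i) =
      M⁻¹ʳ * (star (K i) * X i * K i) * M⁻¹ʳ - M⁻¹ʳ * (star (K i) * K i) - star (K i) * K i * M⁻¹ʳ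
        + star (K i) * (X i)⁻¹ʳ * K i := by
    obtain ⟨x, hx⟩ := (hX i).isUnit
    have hxs : star (x : A) = x := hx ▸ (hX i).isSelfAdjoint
    simp only [star_sub, star_mul, hN, hxs, ← hx, Ring.inverse_unit, sub_mul, mul_sub, mul_assoc,
      Units.mul_inv_cancel_left, Units.inv_mul_cancel_left]
    abel
  have gap : ∑ i, star (X i * K i * M⁻¹ʳ - K i) * (X i)⁻¹ʳ * (X i * K i * M⁻¹ʳ - K i) =
      ∑ i, star (K i) * (X i)⁻¹ʳ * K i - M⁻¹ʳ := by
    simp_rw [expand, Finset.sum_add_distrib, Finset.sum_sub_distrib, ← Finset.sum_mul,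
      ← Finset.mul_sum, hK, ← hMdef, Ring.inverse_mul_cancel M hM.isUnit, mul_one, one_mul]
    abel
  rw [← sub_nonneg, ← gap]
  exact Finset.sum_nonneg fun i _ => star_left_conjugate_nonneg (hX i).ringInverse.nonneg _

lemma CStarConcaveOn.ringInverse (hf : CStarConcaveOn s f)
    (hpos : ∀ a ∈ s, IsStrictlyPositive (f a)) :
    CStarConvexOn s fun a => (f a)⁻¹ʳ := by
  refine ⟨hf.1, fun n K X hK hX => ?_⟩
  have hfX : ∀ i, IsStrictlyPositive (f (X i)) := fun i => hpos _ (hX i)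
  have jensen : ∑ i, star (K i) * f (X i) * K i ≤ f (∑ i, star (K i) * X i * K i) := by
    simpa using neg_le_neg (hf.2 hK hX)
  exact (CStarAlgebra.ringInverse_le_ringInverse jensen
    (cstarConvex_setOf_isStrictlyPositive hK hfX)).trans (cstarConvexOn_ringInverse.2 hK hfX)

lemma cfc_mul_inv_const_add_add_affine {a : A} (ha : 0 ≤ a) (α β γ : ℝ) {t : ℝ} (ht : 0 < t) :
    cfc (fun x : ℝ => γ * (t + x)⁻¹ + (α * x + β)) a =
      γ • ((1 : ℝ) • a + algebraMap ℝ A t)⁻¹ʳ + (α • a + algebraMap ℝ A β) := by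
  have hspec : ∀ x ∈ spectrum ℝ a, t + x ≠ 0 := fun x hx =>
    (add_pos_of_pos_of_nonneg ht (spectrum_nonneg_of_nonneg ha hx)).ne'
  have hinv : ContinuousOn (fun x : ℝ => (t + x)⁻¹) (spectrum ℝ a) := by
    fun_prop (disch := assumption)
  have hresolvent : cfc (fun x : ℝ => (t + x)⁻¹) a = ((1 : ℝ) • a + algebraMap ℝ A t)⁻¹ʳ := by
    rw [cfc_inv _ _ hspec .., cfc_const_add .., cfc_id' .., one_smul, add_comm]
  have haffine : cfc (fun x : ℝ => α * x + β) a = α • a + algebraMap ℝ A β := by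
    rw [cfc_add_const .., cfc_const_mul .., cfc_id' ..]
  rw [cfc_add a (fun x : ℝ => γ * (t + x)⁻¹) (fun x => α * x + β) (continuousOn_const.mul hinv),
    cfc_const_mul _ _ a hinv, hresolvent, haffine]

lemma cstarConvexOn_cfcₙ_mul_inv_const_add_add_affine {f : ℝ → ℝ} {α β γ t : ℝ} (hγ : 0 ≤ γ)
    (ht : 0 < t) (hf : ∀ x, f x = γ * (t + x)⁻¹ + (α * x + β)) (hf0 : f 0 = 0) :
    CStarConvexOn (Ici (0 : A)) (cfcₙ f) := by
  have hresolvent : CStarConvexOn (Ici (0 : A))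
      fun a => ((1 : ℝ) • a + algebraMap ℝ A t)⁻¹ʳ :=
    cstarConvexOn_ringInverse.comp_smul_add_algebraMap cstarConvex_Ici_zero fun a ha => by
      beta_reduce
      rw [one_smul]
      exact (isStrictlyPositive_algebraMap ht).of_le (le_add_of_nonneg_left ha)
  refine ((hresolvent.smul hγ).add
    (cstarConvexOn_smul_add_algebraMap cstarConvex_Ici_zero α β)).congr fun a (ha : 0 ≤ a) => ?_
  have hspec : ∀ x ∈ quasispectrum ℝ a, t + x ≠ 0 := fun x hx =>
    (add_pos_of_pos_of_nonneg ht (quasispectrum_nonneg_of_nonneg a ha x hx)).ne'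
  obtain rfl : f = _ := funext hf
  rw [cfcₙ_eq_cfc (by fun_prop (disch := assumption)) hf0,
    cfc_mul_inv_const_add_add_affine ha α β γ ht]

lemma cstarConcaveOn_cfcₙ_rpowIntegrand₀₁ (p : ℝ) {t : ℝ} (ht : 0 < t) :
    CStarConcaveOn (Ici (0 : A)) (cfcₙ (Real.rpowIntegrand₀₁ p t)) := by
  refine (cstarConvexOn_cfcₙ_mul_inv_const_add_add_affine
    (f := fun x => -Real.rpowIntegrand₀₁ p t x) (α := 0) (β := -(t ^ p * t⁻¹)) (γ := t ^ p)
    (by positivity) ht (fun x => ?_) (by simp)).congr fun a _ => cfcₙ_neg _ a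
  rw [Real.rpowIntegrand₀₁]
  ring

lemma cstarConvexOn_cfcₙ_rpowIntegrand₁₂ (p : ℝ) {t : ℝ} (ht : 0 < t) :
    CStarConvexOn (Ici (0 : A)) (cfcₙ (Real.rpowIntegrand₁₂ p t)) := by
  refine cstarConvexOn_cfcₙ_mul_inv_const_add_add_affine (α := t ^ (p - 1) * t⁻¹)
    (β := -t ^ (p - 1)) (γ := t ^ (p - 1) * t) (by positivity) ht (fun x => ?_)
    (Real.rpowIntegrand₁₂_zero ht)
  rw [Real.rpowIntegrand₁₂]
  ring

lemma cstarConcaveOn_rpow {p : ℝ} (hp : p ∈ Icc (0 : ℝ) 1) :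
    CStarConcaveOn (Ici (0 : A)) fun a => a ^ p := by
  obtain rfl | h0 := hp.1.eq_or_lt
  · exact (cstarConvexOn_smul_add_algebraMap cstarConvex_Ici_zero 0 (-1)).congr
      fun a ha => by simp [CFC.rpow_zero a ha]
  obtain rfl | h1 := hp.2.eq_or_lt
  · exact (cstarConvexOn_smul_add_algebraMap cstarConvex_Ici_zero (-1) 0).congr
      fun a ha => by simp [CFC.rpow_one a ha]
  lift p to NNReal using hp.1
  have hp' : p ∈ Ioo 0 1 := ⟨by exact_mod_cast h0, by exact_mod_cast h1⟩
  obtain ⟨μ, hμ⟩ := CFC.exists_measure_nnrpow_eq_integral_cfcₙ_rpowIntegrand₀₁ A hp'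
  refine (cstarConvexOn_integral (μ := μ.restrict (Ioi 0)) cstarConvex_Ici_zero ?_
    fun a ha => (hμ a ha).1.neg).congr fun a ha => ?_
  · filter_upwards [ae_restrict_mem measurableSet_Ioi] with t ht
    exact cstarConcaveOn_cfcₙ_rpowIntegrand₀₁ p ht
  · simp only [Pi.neg_apply]
    rw [integral_neg, ← (hμ a ha).2, CFC.nnrpow_eq_rpow hp'.1]

lemma cstarConvexOn_rpow_of_mem_Icc_one_two {p : ℝ} (hp : p ∈ Icc (1 : ℝ) 2) :
    CStarConvexOn (Ici (0 : A)) fun a => a ^ p := by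
  obtain rfl | h1 := hp.1.eq_or_lt
  · exact (cstarConvexOn_smul_add_algebraMap cstarConvex_Ici_zero 1 0).congr
      fun a ha => by simp [CFC.rpow_one a ha]
  obtain rfl | h2 := hp.2.eq_or_lt
  · exact (cstarConvexOn_sq.subset (fun _ => IsSelfAdjoint.of_nonneg) cstarConvex_Ici_zero).congr
      fun a ha => (CFC.rpow_natCast a 2 ha).symm
  lift p to NNReal using zero_le_one.trans hp.1
  have hp' : p ∈ Ioo 1 2 := ⟨by exact_mod_cast h1, by exact_mod_cast h2⟩
  obtain ⟨μ, hμ⟩ := CFC.exists_measure_nnrpow_eq_integral_cfcₙ_rpowIntegrand₁₂ A hp'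
  refine (cstarConvexOn_integral (μ := μ.restrict (Ioi 0)) cstarConvex_Ici_zero ?_
    fun a ha => (hμ a ha).1).congr fun a ha => ?_
  · filter_upwards [ae_restrict_mem measurableSet_Ioi] with t ht
    exact cstarConvexOn_cfcₙ_rpowIntegrand₁₂ p ht
  · exact (hμ a ha).2.symm.trans (CFC.nnrpow_eq_rpow (zero_lt_one.trans hp'.1))

lemma cstarConvexOn_rpow_of_mem_Icc_neg_one_zero {p : ℝ} (hp : p ∈ Icc (-1 : ℝ) 0) :
    CStarConvexOn {a : A | IsStrictlyPositive a} fun a => a ^ p := by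
  obtain rfl | h0 := hp.2.eq_or_lt
  · exact (cstarConvexOn_smul_add_algebraMap cstarConvex_setOf_isStrictlyPositive 0 1).congr
      fun a ha => by simp [CFC.rpow_zero a ha.nonneg]
  have hconcave : CStarConcaveOn {a : A | IsStrictlyPositive a} fun a => a ^ (-p) :=
    (cstarConcaveOn_rpow ⟨by linarith, by linarith [hp.1]⟩).subset
      (fun _ => IsStrictlyPositive.nonneg) cstarConvex_setOf_isStrictlyPositive
  refine (hconcave.ringInverse fun a ha => ha.rpow a (-p)).congr fun a ha => ?_
  simp [CFC.inverse_rpow a (-p) (neg_ne_zero.2 h0.ne) ha]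

lemma tendsto_inv_smul_rpow_sub_one_log {a : A} (ha : IsStrictlyPositive a) :
    Tendsto (fun p : ℝ => p⁻¹ • (a ^ p - 1)) (𝓝[>] 0) (𝓝 (CFC.log a)) := by
  refine (CFC.tendsto_cfc_rpow_sub_one_log ha).congr fun p => ?_
  have hcont : ContinuousOn (fun x : ℝ => x ^ p) (spectrum ℝ a) := fun x hx =>
    (Real.continuousAt_rpow_const x p (.inl (ha.spectrum_pos hx).ne')).continuousWithinAt
  rw [cfc_const_mul .., cfc_sub (fun x : ℝ => x ^ p) (fun _ => 1) a, cfc_const_one ..,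
    CFC.rpow_eq_cfc_real ha.nonneg]

lemma cstarConcaveOn_log : CStarConcaveOn {a : A | IsStrictlyPositive a} CFC.log := by
  refine cstarConvexOn_of_tendsto cstarConvex_setOf_isStrictlyPositive ?_
    fun a ha => (tendsto_inv_smul_rpow_sub_one_log ha).neg
  filter_upwards [Ioo_mem_nhdsGT (zero_lt_one (α := ℝ))] with p hp
  have hrpow : CStarConcaveOn {a : A | IsStrictlyPositive a} fun a => a ^ p :=
    (cstarConcaveOn_rpow ⟨hp.1.le, hp.2.le⟩).subset
      (fun _ => IsStrictlyPositive.nonneg) cstarConvex_setOf_isStrictlyPositive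
  refine ((CStarConvexOn.smul hrpow (inv_nonneg.2 hp.1.le)).add
    (cstarConvexOn_smul_add_algebraMap hrpow.1 0 p⁻¹)).congr fun a _ => ?_
  simp [Algebra.algebraMap_eq_smul_one, smul_sub, neg_add_eq_sub]

lemma isStrictlyPositive_one_add_sum_star_mul_self {n : ℕ} (C : Fin n → A) :
    IsStrictlyPositive (1 + ∑ i, star (C i) * C i) :=
  isStrictlyPositive_one.of_le
    (le_add_of_nonneg_right (Finset.sum_nonneg fun i _ => star_mul_self_nonneg (C i)))

theorem mainTheorem7_general {n : ℕ} {B D : A} {Y C : Fin n → A}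
    (hD : D = (1 + ∑ i, star (C i) * C i) ^ (-(1 / 2) : ℝ))
    (hB : IsStrictlyPositive (B - ∑ i, star (C i) * Y i * C i))
    (hY : ∀ i, IsStrictlyPositive (Y i)) :
    IsStrictlyPositive D ∧ IsStrictlyPositive (D * B * D) ∧
    (D⁻¹ʳ * (D * B * D)⁻¹ʳ * D⁻¹ʳ ≤
      (B - ∑ i, star (C i) * Y i * C i)⁻¹ʳ + ∑ i, star (C i) * (Y i)⁻¹ʳ * C i) ∧
    (∀ p : ℝ, p ∈ Icc (-1 : ℝ) 0 ∪ Icc (1 : ℝ) 2 →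
      D⁻¹ʳ * (D * B * D) ^ p * D⁻¹ʳ ≤
        (B - ∑ i, star (C i) * Y i * C i) ^ p + ∑ i, star (C i) * Y i ^ p * C i) ∧
    (∀ p : ℝ, p ∈ Icc (0 : ℝ) 1 →
      (B - ∑ i, star (C i) * Y i * C i) ^ p + ∑ i, star (C i) * Y i ^ p * C i ≤
        D⁻¹ʳ * (D * B * D) ^ p * D⁻¹ʳ) ∧
    (CFC.log (B - ∑ i, star (C i) * Y i * C i) + ∑ i, star (C i) * CFC.log (Y i) * C i ≤
      D⁻¹ʳ * CFC.log (D * B * D) * D⁻¹ʳ) := by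
  have hS := isStrictlyPositive_one_add_sum_star_mul_self C
  have hDpos : IsStrictlyPositive D := hD ▸ hS.rpow _ _
  have hDS : D * (1 + ∑ i, star (C i) * C i) * D = 1 := hD ▸ CFC.conjugate_rpow_neg_one_half _ hS
  have hDs : star D = D := hDpos.isSelfAdjoint
  refine ⟨hDpos, ?_, cstarConvexOn_ringInverse.hua hDpos hDS hB hY, ?_, fun p hp =>
    (cstarConcaveOn_rpow hp).hua hDpos hDS hB.nonneg fun i => (hY i).nonneg,
    cstarConcaveOn_log.hua hDpos hDS hB hY⟩
  · have hmem := cstarConvex_setOf_isStrictlyPositive.conjugate_add_sum_mem (by rwa [hDs]) hB hY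
    rwa [sub_add_cancel, hDs] at hmem
  · rintro p (hp | hp)
    · exact (cstarConvexOn_rpow_of_mem_Icc_neg_one_zero hp).hua hDpos hDS hB hY
    · exact (cstarConvexOn_rpow_of_mem_Icc_one_two hp).hua hDpos hDS hB.nonneg
        fun i => (hY i).nonneg

end CStarAlgebra

theorem mainTheorem7 {H : Type*} [NormedAddCommGroup H] [InnerProductSpace ℂ H]
    [CompleteSpace H] (n : ℕ) (B : H →L[ℂ] H) (A C : Fin n → (H →L[ℂ] H))
    (hB : IsSelfAdjoint B) (hA : ∀ i, IsSelfAdjoint (A i))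
    (hBpos : IsStrictlyPositive (B - ∑ i, star (C i) * A i * C i))
    (hApos : ∀ i, IsStrictlyPositive (A i)) :
    -- the operators whose inverse, power or logarithm occurs on the right are strictly positive
    IsStrictlyPositive (huaD C) ∧ IsStrictlyPositive (huaD C * B * huaD C) ∧
    -- (i)
    (Ring.inverse (huaD C) * Ring.inverse (huaD C * B * huaD C) * Ring.inverse (huaD C) ≤
      Ring.inverse (B - ∑ i, star (C i) * A i * C i) +
        ∑ i, star (C i) * Ring.inverse (A i) * C i) ∧
    -- (ii)
    (∀ p : ℝ, p ∈ Set.Icc (-1 : ℝ) 0 ∪ Set.Icc (1 : ℝ) 2 →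
      Ring.inverse (huaD C) * (huaD C * B * huaD C) ^ p * Ring.inverse (huaD C) ≤
        (B - ∑ i, star (C i) * A i * C i) ^ p + ∑ i, star (C i) * (A i) ^ p * C i) ∧
    -- (iii)
    (∀ p : ℝ, p ∈ Set.Icc (0 : ℝ) 1 →
      (B - ∑ i, star (C i) * A i * C i) ^ p + ∑ i, star (C i) * (A i) ^ p * C i ≤
        Ring.inverse (huaD C) * (huaD C * B * huaD C) ^ p * Ring.inverse (huaD C)) ∧
    -- (iv)
    (CFC.log (B - ∑ i, star (C i) * A i * C i) + ∑ i, star (C i) * CFC.log (A i) * C i ≤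
      Ring.inverse (huaD C) * CFC.log (huaD C * B * huaD C) * Ring.inverse (huaD C)) :=
  mainTheorem7_general rfl hBpos hApos
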